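/- Let $\mathbb N=\{1,2,3,\dots\}$. For a set $X$ let $\mathcal P_f(X)$ be the collection of nonempty finite subsets of $X$, let ${}^{\mathbb N}\mathbb N$ be the set of all functions $\mathbb N\to\mathbb N$, and for $F,G\in\mathcal P_f(\mathbb N)$ write $F<G$ if $\max F<\min G$. A set $B\subseteq\mathbb N$ is a $J$-set if for every $F\in\mathcal P_f({}^{\mathbb N}\mathbb N)$ there are $a\in\mathbb N$ and $\beta\in\mathcal P_f(\mathbb N)$ such that $a+\sum_{t\in\beta}f(t)\in B$ for all $f\in F$. Let $\mathcal J$ be the set of ultrafilters on $\mathbb N$ all of whose members are $J$-sets. For ultrafilters $p,q$ on $\mathbb N$, the ultrafilter $p+q$ is given by: $B\in p+q$ if and only if $\{x:\{y:x+y\in B\}\in q\}\in p$. The tensor product of ultrafilters $p_1,\dots,p_m$ on $\mathbb N$ is the ultrafilter on $\mathbb N^m$ defined recursively by $\bigotimes_{i=1}^1p_i=p_1$ and, for $B\subseteq\mathbb N^{k+1}$, $B\in\bigotimes_{i=1}^{k+1}p_i$ if and only if $\{(x_1,\dots,x_k):\{x_{k+1}:(x_1,\dots,x_{k+1})\in B\}\in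 p_{k+1}\}\in\bigotimes_{i=1}^kp_i$. Let $m\in\mathbb N$ and $A\subseteq\mathbb N^m$. The following two statements are equivalent. (1) There exist functions $\alpha_1,\dots,\alpha_m:\mathcal P_f({}^{\mathbb N}\mathbb N)\to\mathbb N$ and $H_1,\dots,H_m:\mathcal P_f({}^{\mathbb N}\mathbb N)\to\mathcal P_f(\mathbb N)$ such that (a) if $F,G\in\mathcal P_f({}^{\mathbb N}\mathbb N)$ and $F\subsetneq G$, then $\max H_j(F)<\min H_j(G)$ for every $j\in\{1,\dots,m\}$; and (b) for every infinite chain $G_1\subsetneq G_2\subsetneq\cdots$ in $\mathcal P_f({}^{\mathbb N}\mathbb N)$, all $\beta_1<\beta_2<\dots<\beta_m$ in $\mathcal P_f(\mathbb N)$, and all choices of $f_i\in G_i$ $(i\in\mathbb N)$, $$\left(\sum_{i\in\beta_1}\Bigl(\alpha_1(G_i)+\sum_{t\in H_1(G_i)}f_i(t)\Bigr),\ \dots,\ \sum_{i\in\beta_m}\Bigl(\alpha_m(G_i)+\sum_{t\in H_m(G_i)}f_i(t)\Bigr)\right)\in A.$$ (2) There exist $p_1,\dots,p_m\in\mathcal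 J$ with $p_i+p_i=p_i$ for each $i$ such that $A\in\bigotimes_{i=1}^mp_i$. -/

import Mathlib

attribute [local instance] Ultrafilter.add

/-- `Pf X` is the collection of all nonempty finite subsets of `X`. -/
abbrev Pf (X : Type*) := {s : Finset X // s.Nonempty}

/-- For nonempty finite sets `F`, `G` of positive integers, `F < G` in the sense that
`max F < min G`. -/
def Precedes (F G : Pf ℕ+) : Prop :=
  F.1.max' F.2 < G.1.min' G.2

/-- The sum `∑ t ∈ β, g t` of positive integers over a nonempty finite set `β`, as a positive
integer (`ℕ+` has no zero, so the sum is computed in `ℕ`). -/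
def posSum {ι : Type*} (β : Pf ι) (g : ι → ℕ+) : ℕ+ :=
  ⟨∑ t ∈ β.1, (g t : ℕ), Finset.sum_pos (fun t _ => (g t).pos) β.2⟩

/-- `A` is a `J`-set: for every nonempty finite set `F` of sequences of positive integers there
are `a` and a nonempty finite `β` with `a + ∑ t ∈ β, f t ∈ A` for all `f ∈ F`. -/
def IsJSet (A : Set ℕ+) : Prop :=
  ∀ F : Pf (ℕ+ → ℕ+), ∃ (a : ℕ+) (β : Pf ℕ+), ∀ f ∈ F.1, a + posSum β f ∈ A

/-- The set of all ultrafilters on the positive integers all of whose members are `J`-sets. -/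
def JUltrafilters : Set (Ultrafilter ℕ+) :=
  {p | ∀ A ∈ p, IsJSet A}

/-- The tensor product `p₁ ⊗ ⋯ ⊗ p_k` of ultrafilters on `S`, an ultrafilter on `S ^ k`.
See `mem_tensor_one` and `mem_tensor_succ` for the description of its members. The empty tensor
product is the only ultrafilter on the one-point space. -/
def tensor {S : Type*} : (k : ℕ) → (Fin k → Ultrafilter S) → Ultrafilter (Fin k → S)
  | 0, _ => pure Fin.elim0
  | k + 1, p =>
      (tensor k (fun i => p i.castSucc)).bind fun x =>
        (p (Fin.last k)).map fun y => Fin.snoc (α := fun _ => S) x y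

theorem mem_tensor_succ {S : Type*} (k : ℕ) (p : Fin (k + 1) → Ultrafilter S)
    (A : Set (Fin (k + 1) → S)) :
    A ∈ tensor (k + 1) p ↔
      {x : Fin k → S | {y : S | Fin.snoc (α := fun _ => S) x y ∈ A} ∈ p (Fin.last k)} ∈
        tensor k (fun i => p i.castSucc) :=
  Iff.rfl

theorem mem_tensor_one {S : Type*} (p : Fin 1 → Ultrafilter S) (A : Set (Fin 1 → S)) :
    A ∈ tensor 1 p ↔ {y : S | (fun _ => y) ∈ A} ∈ p 0 := by
  rw [mem_tensor_succ]
  have h : ∀ y : S, Fin.snoc (α := fun _ => S) Fin.elim0 y = fun _ : Fin 1 => y := by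
    intro y
    funext i
    fin_cases i
    rfl
  simp only [← h]
  exact Iff.rfl

/-!
A chain sum above `F` is a sum of the values `α G + ∑ t ∈ H G, f t` along a finite chain of sets
`G ⊇ F`.

For (1) ⇒ (2), the chain sums above `F` form a `J`-set, and adding to a given one any chain sum that
starts high enough yields another one. By the Hales–Jewett theorem `J`-sets are partition regular,
so the closed subsemigroup of the ultrafilters in `𝒥` containing all these sets is nonempty, and the
Ellis–Numakura lemma yields an idempotent in it. Chain sums over successive blocks then fill a set
in the tensor product of these idempotents, which (b) puts inside `A`.

For (2) ⇒ (1), induct on `m`. The last coordinate of a vector whose first coordinates are `x` has to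
lie in the section `A_x ∈ p_m`, and only finitely many `x` come from chains below a given `F`. Hence
`α_m F` and `H_m F` are chosen by recursion on `F` so as to meet finitely many requirements, among
them that every sum obtained so far stays in `A_x⋆ = {y ∈ A_x | A_x - y ∈ p_m}` when extended by the
new summand.
-/

variable {X P S ι κ : Type*} {m : ℕ}

theorem coe_posSum (β : Pf ι) (g : ι → ℕ+) : (posSum β g : ℕ) = ∑ t ∈ β.1, (g t : ℕ) := rfl

theorem posSum_singleton (i : ι) (h : ({i} : Finset ι).Nonempty) (g : ι → ℕ+) :
    posSum ⟨{i}, h⟩ g = g i :=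
  PNat.eq <| by simp [coe_posSum]

theorem posSum_insert [DecidableEq ι] {i : ι} {s : Finset ι} (hi : i ∉ s) (hs : s.Nonempty)
    (h : (insert i s).Nonempty) (g : ι → ℕ+) :
    posSum ⟨insert i s, h⟩ g = posSum ⟨s, hs⟩ g + g i :=
  PNat.eq <| by simp [coe_posSum, Finset.sum_insert hi, add_comm]

theorem posSum_union [DecidableEq ι] {s t : Finset ι} (hst : Disjoint s t) (hs : s.Nonempty)
    (ht : t.Nonempty) (h : (s ∪ t).Nonempty) (g : ι → ℕ+) :
    posSum ⟨s ∪ t, h⟩ g = posSum ⟨s, hs⟩ g + posSum ⟨t, ht⟩ g :=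
  PNat.eq <| by simp [coe_posSum, Finset.sum_union hst]

theorem posSum_congr {β : Pf ι} {g g' : ι → ℕ+} (h : ∀ t ∈ β.1, g t = g' t) :
    posSum β g = posSum β g' :=
  PNat.eq <| Finset.sum_congr rfl fun t ht => congrArg _ (h t ht)

open scoped Classical in
/-- The image of a nonempty finite set, as a nonempty finite set. Decidability of equality is
classical, so that it can be used on sets of sequences. -/
noncomputable def Pf.image (g : ι → κ) (β : Pf ι) : Pf κ :=
  ⟨β.1.image g, β.2.image g⟩

theorem Pf.mem_image {g : ι → κ} {β : Pf ι} {k : κ} :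
    k ∈ (β.image g).1 ↔ ∃ i ∈ β.1, g i = k := by
  classical exact Finset.mem_image

theorem posSum_image {g : ι → κ} (hg : g.Injective) (β : Pf ι) (f : κ → ℕ+) :
    posSum (β.image g) f = posSum β (f ∘ g) := by
  classical exact PNat.eq <| Finset.sum_image hg.injOn

theorem Precedes.lt {F G : Pf ℕ+} (h : Precedes F G) {i j : ℕ+} (hi : i ∈ F.1) (hj : j ∈ G.1) :
    i < j :=
  (Finset.le_max' _ _ hi).trans_lt (h.trans_le (Finset.min'_le _ _ hj))

theorem precedes_of_forall_lt {F G : Pf ℕ+} (h : ∀ i ∈ F.1, ∀ j ∈ G.1, i < j) : Precedes F G :=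
  h _ (Finset.max'_mem _ _) _ (Finset.min'_mem _ _)

instance [Nonempty X] : Nonempty (Pf X) :=
  ⟨⟨{Classical.arbitrary X}, Finset.singleton_nonempty _⟩⟩

instance : IsDirectedOrder (Pf X) where
  directed F G := by
    classical
    exact ⟨⟨F.1 ∪ G.1, F.2.inl⟩, Finset.subset_union_left, Finset.subset_union_right⟩

instance [Infinite X] : NoMaxOrder (Pf X) where
  exists_gt F := by
    classical
    obtain ⟨x, hx⟩ := Infinite.exists_notMem_finset F.1
    exact ⟨⟨insert x F.1, Finset.insert_nonempty x F.1⟩, Finset.ssubset_insert hx⟩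

theorem IsJSet.mono {A B : Set ℕ+} (hA : IsJSet A) (h : A ⊆ B) : IsJSet B := fun F =>
  let ⟨a, β, hβ⟩ := hA F
  ⟨a, β, fun f hf => h (hβ f hf)⟩

theorem not_isJSet_empty : ¬ IsJSet ∅ := fun h =>
  let ⟨_, _, hβ⟩ := h ⟨{fun _ => 1}, Finset.singleton_nonempty _⟩
  hβ _ (Finset.mem_singleton_self _)

theorem IsJSet.exists_gt {A : Set ℕ+} (hA : IsJSet A) (F : Pf (ℕ+ → ℕ+)) (n : ℕ+) :
    ∃ (a : ℕ+) (β : Pf ℕ+), (∀ t ∈ β.1, n < t) ∧ ∀ f ∈ F.1, a + posSum β f ∈ A := by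
  obtain ⟨a, β, hβ⟩ := hA (F.image fun f => f ∘ (· + n))
  refine ⟨a, β.image (· + n), fun t ht => ?_, fun f hf => ?_⟩
  · obtain ⟨s, -, rfl⟩ := Pf.mem_image.1 ht
    exact PNat.lt_add_left n s
  · rw [posSum_image (add_left_injective n)]
    exact hβ _ (Pf.mem_image.2 ⟨f, hf, rfl⟩)

/-! ### Partition regularity of `J`-sets -/

section PartitionRegularity

variable [Fintype ι] [Nonempty ι]

/-- The sequence of positive integers attached to a word `w` in letters that name sequences: its
`t`-th term adds up, over the positions `i` of the word, the values of the sequences `e (w i)` at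
pairwise distinct places `φ (t, i)`. -/
def wordSequence (e : κ → ℕ+ → ℕ+) (φ : ℕ+ × ι ↪ ℕ+) (w : ι → κ) (t : ℕ+) : ℕ+ :=
  posSum ⟨Finset.univ, Finset.univ_nonempty⟩ fun i => e (w i) (φ (t, i))

/-- Along a combinatorial line, the fixed positions contribute a constant and the moving positions
contribute a sum of the sequence named by the moving letter. -/
theorem exists_add_posSum_wordSequence_line (e : κ → ℕ+ → ℕ+) (φ : ℕ+ × ι ↪ ℕ+)
    (l : Combinatorics.Line κ ι) (a : ℕ+) (β : Pf ℕ+) :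
    ∃ (b : ℕ+) (γ : Pf ℕ+), ∀ x, a + posSum β (wordSequence e φ (l x)) = b + posSum γ (e x) := by
  classical
  let moving : Finset ι := {i | l.idxFun i = none}
  have hmoving : moving.Nonempty := l.proper.imp fun i hi => by simp [moving, hi]
  let fixedPart (t : ℕ+) (i : ι) : ℕ := (l.idxFun i).elim 0 fun y => e y (φ (t, i))
  let b : ℕ+ := ⟨a + ∑ t ∈ β.1, ∑ i, fixedPart t i, by positivity⟩
  let γ : Pf ℕ+ := ⟨(β.1 ×ˢ moving).map φ, (β.2.product hmoving).map⟩
  refine ⟨b, γ, fun x => PNat.eq ?_⟩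
  have hsplit (t : ℕ+) (i : ι) : (e (l x i) (φ (t, i)) : ℕ) =
      fixedPart t i + if l.idxFun i = none then (e x (φ (t, i)) : ℕ) else 0 := by
    cases h : l.idxFun i <;> simp [fixedPart, h]
  have hb : (b : ℕ) = a + ∑ t ∈ β.1, ∑ i, fixedPart t i := rfl
  simp only [PNat.add_coe, coe_posSum, wordSequence, hsplit, Finset.sum_add_distrib, hb, γ,
    Finset.sum_map, Finset.sum_product, moving, Finset.sum_filter, add_assoc]

end PartitionRegularity

/-- Colour the words whose letters name the test sequences for `A` and `B` by whether
`a + ∑ t ∈ β, wordSequence t` lies in `A`; a monochromatic Hales–Jewett line produces the witness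
for one of the two sets. -/
theorem IsJSet.of_union {A B : Set ℕ+} (h : IsJSet (A ∪ B)) : IsJSet A ∨ IsJSet B := by
  classical
  by_contra! hcon
  obtain ⟨⟨F₁, hF₁⟩, ⟨F₂, hF₂⟩⟩ := hcon.imp not_forall.1 not_forall.1
  obtain ⟨ι, _, hι⟩ := Combinatorics.Line.exists_mono_in_high_dimension ↥(F₁.1 ∪ F₂.1) Prop
  have : Nonempty ι := (hι fun _ => True).elim fun l _ => l.proper.nonempty
  obtain ⟨φ⟩ : Nonempty (ℕ+ × ι ↪ ℕ+) :=
    (nonempty_embedding_nat _).map (·.trans Equiv.pnatEquivNat.symm.toEmbedding)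
  let g : (ι → ↥(F₁.1 ∪ F₂.1)) → ℕ+ → ℕ+ := wordSequence Subtype.val φ
  have : Nonempty ↥(F₁.1 ∪ F₂.1) := F₁.2.inl.to_subtype
  obtain ⟨a, β, hβ⟩ := h ⟨Finset.univ.image g, Finset.univ_nonempty.image g⟩
  have hAB (w) : a + posSum β (g w) ∈ A ∪ B := hβ _ (by simp)
  obtain ⟨l, c, hl⟩ := hι fun w => a + posSum β (g w) ∈ A
  obtain ⟨b, γ, hγ⟩ := exists_add_posSum_wordSequence_line Subtype.val φ l a β
  by_cases hc : c
  · refine hF₁ ⟨b, γ, fun f hf => ?_⟩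
    rw [← hγ ⟨f, Finset.mem_union_left _ hf⟩]
    exact (hl _).mpr hc
  · refine hF₂ ⟨b, γ, fun f hf => ?_⟩
    rw [← hγ ⟨f, Finset.mem_union_right _ hf⟩]
    exact (hAB _).resolve_left fun hA => hc ((hl _).mp hA)

/-- The filter of sets whose complement is not a `J`-set; `JUltrafilters` consists of the
ultrafilters finer than it. -/
def coJSet : Filter ℕ+ :=
  Filter.comk (fun A => ¬ IsJSet A) not_isJSet_empty (fun _ hB _ hAB hA => hB (hA.mono hAB))
    fun _ hA _ hB h => h.of_union.elim hA hB

theorem mem_JUltrafilters_iff_le_coJSet {p : Ultrafilter ℕ+} :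
    p ∈ JUltrafilters ↔ ↑p ≤ coJSet := by
  constructor
  · intro hp A hA
    exact Ultrafilter.compl_notMem_iff.1 fun hAp => hA (hp _ hAp)
  · intro hp A hA
    by_contra hJ
    have : Aᶜ ∈ coJSet := Filter.compl_mem_comk.2 hJ
    exact Ultrafilter.compl_notMem_iff.2 hA (hp this)

theorem exists_mem_JUltrafilters_le {f : Filter ℕ+} (hf : ∀ A ∈ f, IsJSet A) :
    ∃ p ∈ JUltrafilters, ↑p ≤ f := by
  have : (f ⊓ coJSet).NeBot := by
    refine Filter.inf_neBot_iff.2 fun {A} hA {B} hB => ?_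
    by_contra hAB
    rw [← Set.not_disjoint_iff_nonempty_inter, not_not] at hAB
    exact hB ((hf A hA).mono hAB.subset_compl_right)
  have hle := Ultrafilter.of_le (f ⊓ coJSet)
  exact ⟨_, mem_JUltrafilters_iff_le_coJSet.2 (hle.trans inf_le_right), hle.trans inf_le_left⟩

theorem add_mem_JUltrafilters (p : Ultrafilter ℕ+) {q : Ultrafilter ℕ+}
    (hq : q ∈ JUltrafilters) : p + q ∈ JUltrafilters := by
  intro A hA F
  obtain ⟨x, hx⟩ := p.nonempty_of_mem (s := {x | {y | x + y ∈ A} ∈ q}) hA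
  obtain ⟨a, β, hβ⟩ := hq _ hx F
  exact ⟨x + a, β, fun f hf => by rw [add_assoc]; exact hβ f hf⟩

theorem isClosed_setOf_ultrafilter_le (f : Filter S) : IsClosed {p : Ultrafilter S | ↑p ≤ f} := by
  simp only [Filter.le_def, Set.ofPred_forall]
  exact isClosed_biInter fun A _ => ultrafilter_isClosed_basic A

theorem exists_idempotent_mem_JUltrafilters_le {f : Filter ℕ+} (hf : ∀ A ∈ f, IsJSet A)
    (hadd : ∀ A ∈ f, {x | {y | x + y ∈ A} ∈ f} ∈ f) :
    ∃ p ∈ JUltrafilters, p + p = p ∧ ↑p ≤ f := by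
  let T : Set (Ultrafilter ℕ+) := {p | p ∈ JUltrafilters ∧ ↑p ≤ f}
  have hT : IsClosed T := by
    simp only [T, mem_JUltrafilters_iff_le_coJSet]
    exact (isClosed_setOf_ultrafilter_le _).inter (isClosed_setOf_ultrafilter_le _)
  have hTadd : ∀ p ∈ T, ∀ q ∈ T, p + q ∈ T := by
    intro p hp q hq
    refine ⟨add_mem_JUltrafilters p hq.1, fun A hA => ?_⟩
    have hmem : {x | {y | x + y ∈ A} ∈ q} ∈ p :=
      Filter.mem_of_superset (hp.2 (hadd A hA)) fun x hx => hq.2 hx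
    exact hmem
  obtain ⟨p, ⟨hpJ, hpf⟩, hp⟩ := @exists_idempotent_in_compact_add_subsemigroup (Ultrafilter ℕ+)
    Ultrafilter.addSemigroup _ _ Ultrafilter.continuous_add_left T
    (exists_mem_JUltrafilters_le hf) hT.isCompact hTadd
  exact ⟨p, hpJ, hp, hpf⟩

/-- The points of `B` at which the translate of `B` is still `p`-large (`B⋆` in the literature on
the algebra of `βS`). -/
def starSet [Add S] (p : Ultrafilter S) (B : Set S) : Set S :=
  {y | y ∈ B ∧ {z | y + z ∈ B} ∈ p}

section StarSet

variable [AddSemigroup S] {p : Ultrafilter S} {B : Set S}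

theorem starSet_mem (hp : p + p = p) (hB : B ∈ p) : starSet p B ∈ p := by
  refine Filter.inter_mem hB ?_
  rw [← hp] at hB
  exact hB

theorem translate_starSet_mem (hp : p + p = p) {y : S} (hy : y ∈ starSet p B) :
    {z | y + z ∈ starSet p B} ∈ p := by
  refine Filter.mem_of_superset (starSet_mem hp hy.2) fun z hz => ⟨hz.1, ?_⟩
  simpa only [Set.mem_ofPred_eq, add_assoc] using hz.2

end StarSet

/-! ### Finite chains in directed orders -/

section Chains

variable [PartialOrder P]

theorem exists_isGreatest_of_isChain {s : Finset P} (hs : IsChain (· ≤ ·) (s : Set P))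
    (hne : s.Nonempty) : ∃ a, IsGreatest (s : Set P) a :=
  let ⟨a, ha⟩ := s.exists_maximal hne
  ⟨a, ha.1, fun _ hx => (hs.total hx ha.1).elim id (ha.2 hx)⟩

theorem exists_isLeast_of_isChain {s : Finset P} (hs : IsChain (· ≤ ·) (s : Set P))
    (hne : s.Nonempty) : ∃ a, IsLeast (s : Set P) a :=
  exists_isGreatest_of_isChain (P := Pᵒᵈ) hs.symm hne

theorem isChain_induction_on_max [DecidableEq P] {motive : Finset P → Prop} {s : Finset P}
    (hs : IsChain (· ≤ ·) (s : Set P)) (empty : motive ∅)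
    (insert : ∀ a t, insert a t ⊆ s → (∀ x ∈ t, x < a) → motive t → motive (insert a t)) :
    motive s := by
  induction s using Finset.strongInduction with
  | H s ih =>
    rcases s.eq_empty_or_nonempty with rfl | hne
    · exact empty
    obtain ⟨a, ha, hmax⟩ := exists_isGreatest_of_isChain hs hne
    have hsub := s.erase_subset a
    rw [← Finset.insert_erase ha]
    refine insert a _ (Finset.insert_erase ha).subset (fun x hx => ?_)
      (ih _ (Finset.erase_ssubset ha) (hs.mono hsub) fun b t hbt => insert b t (hbt.trans hsub))
    exact (hmax (hsub hx)).lt_of_ne (Finset.ne_of_mem_erase hx)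

theorem strictMono_natCases {a : P} {T : ℕ → P} (ha : a < T 0) (hT : StrictMono T) :
    StrictMono fun n : ℕ => (Nat.casesOn n a T : P) :=
  strictMono_nat_of_lt_succ fun n => n.casesOn ha fun k => hT k.lt_succ_self

/-- The elements of `s` are put in front of `T` one at a time, the largest first. -/
theorem exists_strictMono_range_superset {s : Finset P} (hs : IsChain (· ≤ ·) (s : Set P))
    {T : ℕ → P} (hT : StrictMono T) (hsT : ∀ x ∈ s, x < T 0) :
    ∃ G : ℕ → P, StrictMono G ∧ ↑s ∪ Set.range T ⊆ Set.range G := by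
  classical
  refine isChain_induction_on_max (motive := fun s => ∀ T : ℕ → P, StrictMono T →
    (∀ x ∈ s, x < T 0) → ∃ G : ℕ → P, StrictMono G ∧ ↑s ∪ Set.range T ⊆ Set.range G) hs
    (fun T hT _ => ⟨T, hT, by simp⟩) ?_ T hT hsT
  intro a t _ hta ih T hT hT₀
  obtain ⟨G, hG, hsub⟩ := ih _ (strictMono_natCases (hT₀ a (by simp)) hT) hta
  obtain ⟨hsub, hsubT⟩ := Set.union_subset_iff.1 hsub
  refine ⟨G, hG, ?_⟩
  rw [Finset.coe_insert, Set.union_subset_iff, Set.insert_subset_iff]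
  exact ⟨⟨hsubT ⟨0, rfl⟩, hsub⟩, Set.range_subset_iff.2 fun n => hsubT ⟨n + 1, rfl⟩⟩

theorem exists_strictMono_pnat_range_superset [Nonempty P] [IsDirectedOrder P] [NoMaxOrder P]
    {s : Finset P} (hs : IsChain (· ≤ ·) (s : Set P)) :
    ∃ G : ℕ+ → P, StrictMono G ∧ ↑s ⊆ Set.range G := by
  obtain ⟨b, hb⟩ := s.exists_le
  obtain ⟨c, hbc⟩ := exists_gt b
  obtain ⟨T, hT, rfl⟩ := Nat.exists_strictMono' c
  obtain ⟨G, hG, hsub⟩ := exists_strictMono_range_superset hs hT fun x hx => (hb x hx).trans_lt hbc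
  refine ⟨G ∘ PNat.natPred, hG.comp PNat.natPred_strictMono, ?_⟩
  rw [Function.Surjective.range_comp (f := PNat.natPred) Equiv.pnatEquivNat.surjective]
  exact Set.subset_union_left.trans hsub

/-- A block sequence: finite chains `D₁ < ⋯ < D_m` stacked on top of each other. These are exactly
the images of blocks `β₁ < ⋯ < β_m` under an infinite chain, so that neither the blocks nor the
infinite chain has to be carried along. -/
def IsBlockSequence (D : Fin m → Pf P) : Prop :=
  (∀ j, IsChain (· ≤ ·) ((D j).1 : Set P)) ∧
    ∀ j k, j < k → ∀ F ∈ (D j).1, ∀ G ∈ (D k).1, F < G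

theorem IsBlockSequence.image {G : ℕ+ → P} (hG : StrictMono G) {β : Fin m → Pf ℕ+}
    (hβ : ∀ j k, j < k → Precedes (β j) (β k)) : IsBlockSequence fun j => (β j).image G := by
  refine ⟨fun j => ?_, fun j k hjk F hF K hK => ?_⟩
  · refine hG.monotone.isChain_range.mono fun F hF => ?_
    obtain ⟨i, -, rfl⟩ := Pf.mem_image.1 hF
    exact ⟨i, rfl⟩
  · obtain ⟨i, hi, rfl⟩ := Pf.mem_image.1 hF
    obtain ⟨t, ht, rfl⟩ := Pf.mem_image.1 hK
    exact hG ((hβ j k hjk).lt hi ht)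

theorem IsBlockSequence.isChain_biUnion [DecidableEq P] {D : Fin m → Pf P}
    (hD : IsBlockSequence D) :
    IsChain (· ≤ ·) ((Finset.univ.biUnion fun j => (D j).1 : Finset P) : Set P) := by
  intro F hF G hG hne
  obtain ⟨j, -, hj⟩ := Finset.mem_biUnion.1 hF
  obtain ⟨k, -, hk⟩ := Finset.mem_biUnion.1 hG
  rcases lt_trichotomy j k with hjk | rfl | hkj
  · exact .inl (hD.2 j k hjk F hj G hk).le
  · exact hD.1 j hj hk hne
  · exact .inr (hD.2 k j hkj G hk F hj).le

theorem IsBlockSequence.exists_image_eq [Nonempty P] [IsDirectedOrder P] [NoMaxOrder P]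
    {D : Fin m → Pf P} (hD : IsBlockSequence D) :
    ∃ (G : ℕ+ → P) (β : Fin m → Pf ℕ+), StrictMono G ∧
      (∀ j k, j < k → Precedes (β j) (β k)) ∧ ∀ j, (β j).image G = D j := by
  classical
  obtain ⟨G, hG, hDG⟩ := exists_strictMono_pnat_range_superset hD.isChain_biUnion
  have himage (j) : ∃ β : Pf ℕ+, β.image G = D j := by
    have hj : ((D j).1 : Set P) ⊆ Set.range G := fun F hF =>
      hDG (Finset.mem_biUnion.2 ⟨j, Finset.mem_univ j, hF⟩)
    obtain ⟨β, hβ⟩ := Finset.subset_set_image_iff.1 (Set.image_univ ▸ hj)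
    have hne : β.Nonempty := Finset.image_nonempty.1 (hβ.2 ▸ (D j).2)
    exact ⟨⟨β, hne⟩, Subtype.ext (by simpa [Pf.image] using hβ.2)⟩
  choose β hβ using himage
  refine ⟨G, β, hG, fun j k hjk => precedes_of_forall_lt fun i hi t ht => ?_, hβ⟩
  refine hG.lt_iff_lt.1 (hD.2 j k hjk _ ?_ _ ?_)
  · exact hβ j ▸ Pf.mem_image.2 ⟨i, hi, rfl⟩
  · exact hβ k ▸ Pf.mem_image.2 ⟨t, ht, rfl⟩

theorem IsBlockSequence.snoc {D : Fin m → Pf P} (hD : IsBlockSequence D) {E : Pf P}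
    (hE : IsChain (· ≤ ·) (E.1 : Set P)) (hDE : ∀ j, ∀ F ∈ (D j).1, ∀ G ∈ E.1, F < G) :
    IsBlockSequence (Fin.snoc (α := fun _ => Pf P) D E) := by
  refine ⟨Fin.lastCases (by simpa using hE) (by simpa using hD.1), fun j k hjk => ?_⟩
  cases k using Fin.lastCases with
  | last =>
    cases j using Fin.lastCases with
    | last => exact absurd hjk (lt_irrefl _)
    | cast j => simpa using hDE j
  | cast k =>
    cases j using Fin.lastCases with
    | last => exact absurd hjk (Fin.le_last _).not_gt
    | cast j => simpa using hD.2 j k hjk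

theorem IsBlockSequence.init {D : Fin (m + 1) → Pf P} (hD : IsBlockSequence D) :
    IsBlockSequence (Fin.init D) :=
  ⟨fun j => hD.1 j.castSucc, fun _ _ hjk => hD.2 _ _ (Fin.castSucc_lt_castSucc_iff.2 hjk)⟩

end Chains

/-! ### Sums along chains -/

/-- A choice of an element from every nonempty finite set. It encodes the choices `f_i ∈ G_i` for
all chains `G` at once. -/
def IsSelection (f : Pf X → X) : Prop :=
  ∀ G, f G ∈ G.1

theorem exists_isSelection : ∃ f : Pf X → X, IsSelection f :=
  Classical.skolem.1 fun G : Pf X => G.2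

theorem IsSelection.ite {f g : Pf X → X} (hf : IsSelection f) (hg : IsSelection g)
    (q : Pf X → Prop) [DecidablePred q] : IsSelection fun G => if q G then f G else g G := by
  intro G
  dsimp only
  split_ifs
  exacts [hf G, hg G]

/-- The vector of the sums of `v j G (f G)` over `G ∈ D j`. With `v j = jSummand (α j) (H j)` it is
the vector in condition (b), the terms of the chain serving as their own indices. -/
def blockSum (v : Fin m → Pf X → X → ℕ+) (D : Fin m → Pf (Pf X)) (f : Pf X → X) : Fin m → ℕ+ :=
  fun j => posSum (D j) fun G => v j G (f G)

theorem forall_blockSum_mem_iff [Infinite X] {v : Fin m → Pf X → X → ℕ+} {A : Set (Fin m → ℕ+)} :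
    (∀ D, IsBlockSequence D → ∀ f, IsSelection f → blockSum v D f ∈ A) ↔
      ∀ G : ℕ+ → Pf X, (∀ i, (G i).1 ⊂ (G (i + 1)).1) →
        ∀ β : Fin m → Pf ℕ+, (∀ j k, j < k → Precedes (β j) (β k)) →
          ∀ f : ℕ+ → X, (∀ i, f i ∈ (G i).1) →
            (fun j => posSum (β j) fun i => v j (G i) (f i)) ∈ A := by
  constructor
  · intro h G hGsucc β hβ f hf
    have hG : StrictMono G := strictMono_of_lt_add_one fun i _ => hGsucc i
    obtain ⟨s, hs⟩ := exists_isSelection (X := X)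
    have hsel : IsSelection (Function.extend G f s) := fun K => by
      by_cases hK : ∃ i, G i = K
      · obtain ⟨i, rfl⟩ := hK
        rw [hG.injective.extend_apply]
        exact hf i
      · rw [Function.extend_apply' _ _ _ hK]
        exact hs K
    convert h _ (.image hG hβ) _ hsel using 1
    funext j
    simp only [blockSum, posSum_image hG.injective, Function.comp_def, hG.injective.extend_apply]
  · intro h D hD f hf
    obtain ⟨G, β, hG, hβ, hGβ⟩ := hD.exists_image_eq
    convert h G (fun i => hG (PNat.lt_add_right i 1)) β hβ (f ∘ G) fun i => hf (G i) using 1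
    funext j
    rw [blockSum, ← hGβ j, posSum_image hG.injective]
    rfl

/-- The sums of `v G (f G)` over finite chains of sets `G ⊇ F`, for arbitrary selections `f`: the
values that a single coordinate in condition (b) takes when the chain starts above `F`. -/
def chainSums (v : Pf X → X → ℕ+) (F : Pf X) : Set ℕ+ :=
  {y | ∃ D : Pf (Pf X), IsChain (· ≤ ·) (D.1 : Set (Pf X)) ∧ (∀ G ∈ D.1, F ≤ G) ∧
    ∃ f, IsSelection f ∧ posSum D (fun G => v G (f G)) = y}

theorem chainSums_antitone (v : Pf X → X → ℕ+) : Antitone (chainSums v) :=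
  fun _ _ hFF' _ ⟨D, hD, hF, hy⟩ => ⟨D, hD, fun G hG => hFF'.trans (hF G hG), hy⟩

theorem mem_chainSums_self (v : Pf X → X → ℕ+) {G : Pf X} {g : X} (hg : g ∈ G.1) :
    v G g ∈ chainSums v G := by
  classical
  obtain ⟨s, hs⟩ := exists_isSelection (X := X)
  refine ⟨⟨{G}, Finset.singleton_nonempty G⟩, by simp, by simp, Function.update s G g, ?_, by
    simp [posSum_singleton]⟩
  exact (Function.forall_update_iff s fun K x => x ∈ K.1).2 ⟨hg, fun K _ => hs K⟩

theorem exists_add_mem_chainSums [Infinite X] {v : Pf X → X → ℕ+} {F : Pf X} {x : ℕ+}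
    (hx : x ∈ chainSums v F) : ∃ F', ∀ y ∈ chainSums v F', x + y ∈ chainSums v F := by
  classical
  obtain ⟨D, hD, hFD, f, hf, rfl⟩ := hx
  obtain ⟨K, hK⟩ := D.1.exists_le
  obtain ⟨F', hKF'⟩ := exists_gt K
  refine ⟨F', ?_⟩
  rintro _ ⟨E, hE, hF'E, g, hg, rfl⟩
  have hDE : ∀ G ∈ D.1, ∀ G' ∈ E.1, G < G' := fun G hG G' hG' =>
    (hK G hG).trans_lt (hKF'.trans_le (hF'E G' hG'))
  have hFE : ∀ G ∈ E.1, F ≤ G := fun G hG =>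
    let ⟨G₀, hG₀⟩ := D.2
    (hFD G₀ hG₀).trans (hDE G₀ hG₀ G hG).le
  have hdisj : Disjoint D.1 E.1 := Finset.disjoint_left.2 fun G hG hG' => (hDE G hG G hG').false
  refine ⟨⟨D.1 ∪ E.1, D.2.inl⟩, ?_, ?_, _, hf.ite hg (· ∈ D.1), ?_⟩
  · rw [Finset.coe_union, isChain_union]
    exact ⟨hD, hE, fun G hG G' hG' _ => .inl (hDE G hG G' hG').le⟩
  · exact fun G hG => (Finset.mem_union.1 hG).elim (hFD G) (hFE G)
  · rw [posSum_union hdisj D.2 E.2]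
    refine congrArg₂ (· + ·) (posSum_congr fun G hG => ?_) (posSum_congr fun G hG => ?_)
    · rw [if_pos hG]
    · rw [if_neg (Finset.disjoint_right.1 hdisj hG)]

/-- The filter generated by the sets `chainSums v F`, which collects the properties of the sums over
chains that start far enough up. -/
def chainFilter (v : Pf X → X → ℕ+) : Filter ℕ+ :=
  ⨅ F, Filter.principal (chainSums v F)

theorem hasBasis_chainFilter [Nonempty X] (v : Pf X → X → ℕ+) :
    (chainFilter v).HasBasis (fun _ => True) (chainSums v) :=
  Filter.hasBasis_iInf_principal (chainSums_antitone v).directed_ge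

/-- The summand `α(G) + ∑ t ∈ H(G), f(t)` of condition (b), as a function of `G` and `f`. -/
def jSummand (α : Pf (ℕ+ → ℕ+) → ℕ+) (H : Pf (ℕ+ → ℕ+) → Pf ℕ+) (G : Pf (ℕ+ → ℕ+))
    (f : ℕ+ → ℕ+) : ℕ+ :=
  α G + posSum (H G) f

theorem isJSet_chainSums_jSummand (α : Pf (ℕ+ → ℕ+) → ℕ+) (H : Pf (ℕ+ → ℕ+) → Pf ℕ+)
    (F : Pf (ℕ+ → ℕ+)) : IsJSet (chainSums (jSummand α H) F) := by
  intro K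
  obtain ⟨G, hFG, hKG⟩ := exists_ge_ge F K
  exact ⟨α G, H G, fun f hf =>
    chainSums_antitone _ hFG (mem_chainSums_self (jSummand α H) (hKG hf))⟩

theorem exists_idempotent_chainSums_mem (α : Pf (ℕ+ → ℕ+) → ℕ+) (H : Pf (ℕ+ → ℕ+) → Pf ℕ+) :
    ∃ p : Ultrafilter ℕ+, (p ∈ JUltrafilters ∧ p + p = p) ∧
      ∀ F, chainSums (jSummand α H) F ∈ p := by
  have hbasis := hasBasis_chainFilter (jSummand α H)
  have hJ : ∀ A ∈ chainFilter (jSummand α H), IsJSet A := by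
    intro A hA
    obtain ⟨F, -, hF⟩ := hbasis.mem_iff.1 hA
    exact (isJSet_chainSums_jSummand α H F).mono hF
  have hadd : ∀ A ∈ chainFilter (jSummand α H),
      {x | {y | x + y ∈ A} ∈ chainFilter (jSummand α H)} ∈ chainFilter (jSummand α H) := by
    intro A hA
    obtain ⟨F, -, hF⟩ := hbasis.mem_iff.1 hA
    refine hbasis.mem_iff.2 ⟨F, trivial, fun x hx => ?_⟩
    obtain ⟨F', hF'⟩ := exists_add_mem_chainSums hx
    exact hbasis.mem_iff.2 ⟨F', trivial, fun y hy => hF (hF' y hy)⟩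
  obtain ⟨p, hpJ, hpp, hp⟩ := exists_idempotent_mem_JUltrafilters_le hJ hadd
  exact ⟨p, ⟨hpJ, hpp⟩, fun F => hp (hbasis.mem_of_mem trivial)⟩

theorem blockSum_snoc {v : Fin (m + 1) → Pf X → X → ℕ+} {D : Fin m → Pf (Pf X)} {E : Pf (Pf X)}
    {f : Pf X → X} :
    blockSum v (Fin.snoc (α := fun _ => Pf (Pf X)) D E) f =
      Fin.snoc (α := fun _ => ℕ+) (blockSum (fun j => v j.castSucc) D f)
        (posSum E fun G => v (Fin.last m) G (f G)) := by
  funext j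
  cases j using Fin.lastCases <;> simp [blockSum]

theorem blockSums_mem_tensor [Infinite X] {v : Fin m → Pf X → X → ℕ+}
    {p : Fin m → Ultrafilter ℕ+} (hp : ∀ j F, chainSums (v j) F ∈ p j) :
    {x | ∃ D f, IsBlockSequence D ∧ IsSelection f ∧ blockSum v D f = x} ∈ tensor m p := by
  classical
  induction m with
  | zero =>
    obtain ⟨f, hf⟩ := exists_isSelection (X := X)
    exact ⟨Fin.elim0, f, ⟨fun j => j.elim0, fun j => j.elim0⟩, hf, Subsingleton.elim _ _⟩
  | succ m ih =>
    rw [mem_tensor_succ]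
    refine Filter.mem_of_superset (ih fun j => hp j.castSucc) ?_
    rintro _ ⟨D, f, hD, hf, rfl⟩
    obtain ⟨K, hK⟩ := (Finset.univ.biUnion fun j => (D j).1).exists_le
    obtain ⟨F, hKF⟩ := exists_gt K
    have hDF : ∀ j, ∀ G ∈ (D j).1, G < F := fun j G hG =>
      (hK G (Finset.mem_biUnion.2 ⟨j, Finset.mem_univ j, hG⟩)).trans_lt hKF
    refine Filter.mem_of_superset (hp (Fin.last m) F) ?_
    rintro _ ⟨E, hE, hFE, g, hg, rfl⟩
    refine ⟨_, _, hD.snoc hE fun j G hG G' hG' => (hDF j G hG).trans_le (hFE G' hG'),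
      hf.ite hg (· < F), ?_⟩
    rw [blockSum_snoc]
    refine congrArg₂ _ (funext fun j => posSum_congr fun G hG => ?_)
      (posSum_congr fun G hG => ?_)
    · simp only [if_pos (hDF j G hG)]
    · rw [if_neg (hFE G hG).not_gt]

/-! ### Choosing `α` and `H` recursively -/

theorem exists_forall_lt_le [Preorder P] [LocallyFiniteOrderBot P] [Preorder S]
    [IsDirectedOrder S] [Nonempty S] (c : P → S → S) :
    ∃ b : P → S, ∀ F G, F < G → c F (b F) ≤ b G := by
  have hbound (G : P) (r : ∀ F, F < G → S) : ∃ s, ∀ F (h : F < G), c F (r F h) ≤ s :=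
    have : Finite {F // F < G} := Set.finite_Iio G
    let ⟨s, hs⟩ := Finite.exists_le fun F : {F // F < G} => c F (r F F.2)
    ⟨s, fun F h => hs ⟨F, h⟩⟩
  choose s hs using hbound
  have hcard : StrictMono fun G : P => (Finset.Iio G).card := fun F G h =>
    Finset.card_lt_card (Finset.Iio_ssubset_Iio h)
  have := hcard.wellFoundedLT
  refine ⟨wellFounded_lt.fix s, fun F G h => ?_⟩
  rw [wellFounded_lt.fix_eq s G]
  exact hs G (fun F _ => wellFounded_lt.fix s F) F h

theorem chainSums_subset_of_bound {v : Pf X → X → ℕ+} {b : Pf X → ℕ+} {F : Pf X} {B : Set ℕ+}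
    (hb : ∀ G G', G < G' → ∀ f ∈ G.1, b G + v G f ≤ b G')
    (hB : ∀ G, F ≤ G → ∀ f ∈ G.1, v G f ∈ B ∧ ∀ y ∈ B, y ≤ b G → y + v G f ∈ B) :
    chainSums v F ⊆ B := by
  classical
  rintro _ ⟨⟨D, hne⟩, hD, hFD, f, hf, rfl⟩
  let u (G : Pf X) : ℕ+ := v G (f G)
  suffices h : ∀ hne : D.Nonempty, posSum ⟨D, hne⟩ u ∈ B ∧
      ∀ G', (∀ G ∈ D, G < G') → posSum ⟨D, hne⟩ u ≤ b G' from (h hne).1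
  refine isChain_induction_on_max (motive := fun D => ∀ hne : D.Nonempty, posSum ⟨D, hne⟩ u ∈ B ∧
    ∀ G', (∀ G ∈ D, G < G') → posSum ⟨D, hne⟩ u ≤ b G') hD
    (fun h => absurd h Finset.not_nonempty_empty) ?_
  intro G t hGt htG ih hne
  obtain ⟨hvB, haddB⟩ := hB G (hFD G (hGt (Finset.mem_insert_self G t))) (f G) (hf G)
  have hlast (G') (hG' : ∀ K ∈ insert G t, K < G') : b G + v G (f G) ≤ b G' :=
    hb G G' (hG' G (Finset.mem_insert_self G t)) (f G) (hf G)
  rcases t.eq_empty_or_nonempty with rfl | ht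
  · simp only [insert_empty_eq, posSum_singleton]
    exact ⟨hvB, fun G' hG' => (PNat.lt_add_left _ _).le.trans (hlast G' hG')⟩
  · obtain ⟨hsumB, hsum_le⟩ := ih ht
    rw [posSum_insert (fun h => (htG G h).false) ht]
    exact ⟨haddB _ hsumB (hsum_le G htG), fun G' hG' =>
      (add_le_add_left (hsum_le G htG) _).trans (hlast G' hG')⟩

theorem exists_summand_starSet {p : Ultrafilter ℕ+} (hpJ : p ∈ JUltrafilters) (hpp : p + p = p)
    {B : ι → Set ℕ+} (hB : ∀ i, B i ∈ p) {K : Set ι} (hK : K.Finite) (F : Pf (ℕ+ → ℕ+)) (b : ℕ+) :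
    ∃ (a : ℕ+) (h : Pf ℕ+), (∀ t ∈ h.1, b < t) ∧ ∀ f ∈ F.1, ∀ i ∈ K,
      a + posSum h f ∈ starSet p (B i) ∧
        ∀ y ∈ starSet p (B i), y ≤ b → y + (a + posSum h f) ∈ starSet p (B i) := by
  have hmem : ⋂ i ∈ K, (starSet p (B i) ∩
      ⋂ y ∈ starSet p (B i) ∩ Set.Iic b, {z | y + z ∈ starSet p (B i)}) ∈ p := by
    refine (Filter.biInter_mem hK).2 fun i _ => Filter.inter_mem (starSet_mem hpp (hB i)) ?_
    exact (Filter.biInter_mem ((Set.finite_Iic b).inter_of_right _)).2 fun y hy =>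
      translate_starSet_mem hpp hy.1
  obtain ⟨a, h, hbh, hah⟩ := (hpJ _ hmem).exists_gt F b
  refine ⟨a, h, hbh, fun f hf i hi => ?_⟩
  obtain ⟨hstar, hadd⟩ := Set.mem_iInter₂.1 (hah f hf) i hi
  exact ⟨hstar, fun y hy hyb => Set.mem_iInter₂.1 hadd y ⟨hy, hyb⟩⟩

/-- The one-dimensional construction: the requirement `B i` has to be met only by chains above some
`F` with `i ∈ K F`, so that each `α G`, `H G` faces finitely many requirements. -/
theorem exists_chainSums_subset {p : Ultrafilter ℕ+} (hpJ : p ∈ JUltrafilters) (hpp : p + p = p)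
    {B : ι → Set ℕ+} (hB : ∀ i, B i ∈ p) {K : Pf (ℕ+ → ℕ+) → Set ι} (hK : ∀ F, (K F).Finite) :
    ∃ (α : Pf (ℕ+ → ℕ+) → ℕ+) (H : Pf (ℕ+ → ℕ+) → Pf ℕ+),
      (∀ F G : Pf (ℕ+ → ℕ+), F.1 ⊂ G.1 → Precedes (H F) (H G)) ∧
        ∀ F, ∀ i ∈ K F, chainSums (jSummand α H) F ⊆ B i := by
  classical
  choose a h hbh hstar using fun F => exists_summand_starSet hpJ hpp hB
    ((Set.finite_Iic F).biUnion fun F' _ => hK F') F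
  have hbound (F : Pf (ℕ+ → ℕ+)) (b : ℕ+) : ∃ c, (∀ t ∈ (h F b).1, t ≤ c) ∧
      ∀ f ∈ F.1, b + (a F b + posSum (h F b) f) ≤ c := by
    obtain ⟨c, hc⟩ := ((h F b).1 ∪ F.1.image fun f => b + (a F b + posSum (h F b) f)).exists_le
    exact ⟨c, fun t ht => hc t (Finset.mem_union_left _ ht), fun f hf =>
      hc _ (Finset.mem_union_right _ (Finset.mem_image_of_mem _ hf))⟩
  choose c hct hcf using hbound
  obtain ⟨b, hb⟩ := exists_forall_lt_le c
  refine ⟨fun F => a F (b F), fun F => h F (b F), fun F G hFG => ?_, fun F i hi => ?_⟩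
  · exact precedes_of_forall_lt fun s hs t ht =>
      ((hct F (b F) s hs).trans (hb F G hFG)).trans_lt (hbh G (b G) t ht)
  · refine (chainSums_subset_of_bound (B := starSet p (B i))
      (fun G G' hG f hf => (hcf G (b G) f hf).trans (hb G G' hG)) fun G hFG f hf => ?_).trans
      fun y hy => hy.1
    exact hstar G (b G) f hf i (Set.mem_biUnion hFG hi)

theorem finite_posSum_lt (v : Pf X → X → ℕ+) (F : Pf X) :
    {y | ∃ (D : Pf (Pf X)) (f : Pf X → X), (∀ G ∈ D.1, G < F) ∧ IsSelection f ∧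
      posSum D (fun G => v G (f G)) = y}.Finite := by
  classical
  let n : ℕ := ∑ G ∈ Finset.Iio F, ∑ g ∈ G.1, (v G g : ℕ)
  refine (Set.finite_Iic n.succPNat).subset ?_
  rintro _ ⟨D, f, hDF, hf, rfl⟩
  rw [Set.mem_Iic, ← PNat.coe_le_coe, coe_posSum]
  calc ∑ G ∈ D.1, (v G (f G) : ℕ)
      ≤ ∑ G ∈ D.1, ∑ g ∈ G.1, (v G g : ℕ) := Finset.sum_le_sum fun G _ =>
        Finset.single_le_sum (f := fun g => (v G g : ℕ)) (fun _ _ => Nat.zero_le _) (hf G)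
    _ ≤ n := Finset.sum_le_sum_of_subset fun G hG => Finset.mem_Iio.2 (hDF G hG)
    _ ≤ n.succPNat := n.le_succ

theorem finite_blockSum_lt (v : Fin m → Pf X → X → ℕ+) (F : Pf X) :
    {x | ∃ (D : Fin m → Pf (Pf X)) (f : Pf X → X), (∀ j, ∀ G ∈ (D j).1, G < F) ∧
      IsSelection f ∧ blockSum v D f = x}.Finite := by
  refine (Set.Finite.pi' fun j => finite_posSum_lt (v j) F).subset ?_
  rintro _ ⟨D, f, hDF, hf, rfl⟩ j
  exact ⟨D j, f, hDF j, hf, rfl⟩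

theorem exists_forall_blockSum_mem {p : Fin m → Ultrafilter ℕ+}
    (hp : ∀ j, p j ∈ JUltrafilters ∧ p j + p j = p j) {A : Set (Fin m → ℕ+)}
    (hA : A ∈ tensor m p) :
    ∃ (α : Fin m → Pf (ℕ+ → ℕ+) → ℕ+) (H : Fin m → Pf (ℕ+ → ℕ+) → Pf ℕ+),
      (∀ (j : Fin m) (F G : Pf (ℕ+ → ℕ+)), F.1 ⊂ G.1 → Precedes (H j F) (H j G)) ∧
        ∀ D, IsBlockSequence D → ∀ f, IsSelection f →
          blockSum (fun j => jSummand (α j) (H j)) D f ∈ A := by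
  induction m with
  | zero =>
    refine ⟨Fin.elim0, Fin.elim0, fun j => j.elim0, fun D _ f _ => ?_⟩
    rw [Subsingleton.elim (blockSum _ D f) Fin.elim0]
    exact hA
  | succ m ih =>
    rw [mem_tensor_succ] at hA
    set A' : Set (Fin m → ℕ+) := {x | {y | Fin.snoc (α := fun _ => ℕ+) x y ∈ A} ∈ p (Fin.last m)}
    obtain ⟨α, H, hH, hA'⟩ := ih (fun j => hp j.castSucc) hA
    let v (j : Fin m) := jSummand (α j) (H j)
    obtain ⟨α', H', hH', hsub⟩ := exists_chainSums_subset (hp (Fin.last m)).1 (hp (Fin.last m)).2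
      (B := fun x : A' => {y | Fin.snoc (α := fun _ => ℕ+) x.1 y ∈ A}) (fun x => x.2)
      fun F => (finite_blockSum_lt v F).preimage Subtype.val_injective.injOn
    refine ⟨Fin.snoc (α := fun _ => _ → ℕ+) α α', Fin.snoc (α := fun _ => _ → Pf ℕ+) H H',
      Fin.lastCases (by simpa using hH') (by simpa using hH), fun D hD f hf => ?_⟩
    obtain ⟨F, hF, hFmin⟩ := exists_isLeast_of_isChain (hD.1 (Fin.last m)) (D (Fin.last m)).2
    have hx : blockSum v (Fin.init D) f ∈ A' := hA' _ hD.init f hf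
    have hlt (j : Fin m) : ∀ G ∈ (D j.castSucc).1, G < F := fun G hG =>
      hD.2 _ _ j.castSucc_lt_last G hG F hF
    have hy : posSum (D (Fin.last m)) (fun G => jSummand α' H' G (f G)) ∈
        chainSums (jSummand α' H') F := ⟨_, hD.1 _, fun G hG => hFmin hG, f, hf, rfl⟩
    rw [← Fin.snoc_init_self D, blockSum_snoc]
    simpa using hsub F ⟨_, hx⟩ ⟨_, f, hlt, hf, rfl⟩ hy

theorem corollary1p19 (m : ℕ) (hm : 1 ≤ m) (A : Set (Fin m → ℕ+)) :
    (∃ (α : Fin m → Pf (ℕ+ → ℕ+) → ℕ+) (H : Fin m → Pf (ℕ+ → ℕ+) → Pf ℕ+),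
      (∀ (j : Fin m) (F G : Pf (ℕ+ → ℕ+)), F.1 ⊂ G.1 → Precedes (H j F) (H j G)) ∧
      (∀ G : ℕ+ → Pf (ℕ+ → ℕ+), (∀ i, (G i).1 ⊂ (G (i + 1)).1) →
        ∀ β : Fin m → Pf ℕ+, (∀ j k : Fin m, j < k → Precedes (β j) (β k)) →
          ∀ f : ℕ+ → ℕ+ → ℕ+, (∀ i, f i ∈ (G i).1) →
            (fun j : Fin m =>
              posSum (β j) fun i => α j (G i) + posSum (H j (G i)) (f i)) ∈ A)) ↔
    ∃ p : Fin m → Ultrafilter ℕ+,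
      (∀ j, p j ∈ JUltrafilters ∧ p j + p j = p j) ∧ A ∈ tensor m p := by
  constructor
  · rintro ⟨α, H, -, hA⟩
    choose p hp hchain using fun j => exists_idempotent_chainSums_mem (α j) (H j)
    refine ⟨p, hp, Filter.mem_of_superset (blockSums_mem_tensor hchain) ?_⟩
    rintro _ ⟨D, f, hD, hf, rfl⟩
    exact forall_blockSum_mem_iff.2 hA D hD f hf
  · rintro ⟨p, hp, hA⟩
    obtain ⟨α, H, hH, hblock⟩ := exists_forall_blockSum_mem hp hA
    exact ⟨α, H, hH, forall_blockSum_mem_iff.1 hblock⟩
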